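/- Let $C$ be an ordered field and $I$ a nonempty index set. An $I$-ordered $C$-vector space is a $C$-vector space $G$ with a family $(<_i)_{i\in I}$ of total orderings such that $G$ is an ordered $C$-vector space with respect to each $<_i$ (each $<_i$ is translation invariant, and $\lambda x>_i 0$ whenever $\lambda>0$ in $C$ and $x>_i0$). Put $G_{\pm\infty}=G\cup\{-\infty,\infty\}$ with $-\infty<_iG<_i\infty$ for all $i$. The family $(<_i)_{i\in I}$ is independent if for all $n$, all distinct $i_1,\dots,i_n\in I$ and all $a_1,b_1,\dots,a_n,b_n\in G_{\pm\infty}$ with $a_k<_{i_k}b_k$ for $k=1,\dots,n$, there is $s\in G$ with $a_k<_{i_k}s<_{i_k}b_k$ for $k=1,\dots,n$. Let $T_{C,I}$ be the theory, in the language $\{0,+,(\lambda_c)_{c\in C}\}\cup\{<_i:i\in I\}$, whose models are precisely the $I$-ordered $C$-vector spaces with independent family of orderings. Then $T_{C,I}$ is distal. That is, $T_{C,I}$ is complete, and for every model $\mathbb M$ of $T_{C,I}$ (in particular for a monster model), every $A\subseteq\mathbb M$, every $n\in\mathbb N$ and every ($\emptyset$-)indiscernible sequence $(a_j)_{j\in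 J}$ of elements of $\mathbb M^n$, indexed by a linearly ordered set $J$: if $J=J_1+(c)+J_2$ with $J_1$ and $J_2$ infinite and $(a_j)_{j\in J_1+J_2}$ is $A$-indiscernible, then $(a_j)_{j\in J}$ is $A$-indiscernible. -/

import Mathlib

open FirstOrder

universe u v w w'

namespace DistalTCI

/-! ### Indiscernible sequences and distality -/

section Distality


variable (L : FirstOrder.Language.{u, v}) {M : Type w} [L.Structure M]

/-- The sequence `(a j)_{j ∈ J}` of `n`-tuples from `M`, indexed by the linear order `J`, is
`A`-indiscernible: increasing finite subsequences of the same length satisfy the same formulas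
with parameters from `A`. -/
def Indiscernible (A : Set M) {J : Type w'} [LinearOrder J] {n : ℕ} (a : J → Fin n → M) : Prop :=
  ∀ (k : ℕ) (φ : L[[A]].Formula (Fin k × Fin n)) (s t : Fin k → J), StrictMono s → StrictMono t →
    (φ.Realize (fun p => a (s p.1) p.2) ↔ φ.Realize (fun p => a (t p.1) p.2))

variable (M) in
/-- The distality condition inside the structure `M`: if `J = J₁ + (c) + J₂` with `J₁`, `J₂`
infinite, if `(a j)_{j ∈ J}` is `∅`-indiscernible and if `(a j)_{j ∈ J₁ + J₂}` is
`A`-indiscernible, then `(a j)_{j ∈ J}` is `A`-indiscernible. -/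
def DistalIn : Prop :=
  ∀ (A : Set M) (n : ℕ) (J : Type w') [LinearOrder J] (c : J) (a : J → Fin n → M),
    (Set.Iio c).Infinite → (Set.Ioi c).Infinite →
    Indiscernible L (∅ : Set M) a →
    Indiscernible L A (fun j : {j : J // j ≠ c} => a j) →
    Indiscernible L A a

variable {L} in
/-- A theory is distal if it is complete and satisfies the distality condition in all of its
models (in particular in every monster model). Every finite fragment of a counterexample in some
model is visible in a sufficiently saturated model, so for a complete theory this is the same as
the condition in one fixed monster model. -/
structure IsDistal (T : L.Theory) : Prop where
  isComplete : T.IsComplete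
  distalIn : ∀ (M : Type w) [L.Structure M], M ⊨ T → DistalIn.{u, v, w, w'} L M

end Distality

/-! ### `I`-ordered `C`-vector spaces -/

section Spaces


variable {I : Type v} {G : Type w}

/-- An `I`-ordered `C`-vector space: a `C`-vector space `G` with a family of (strict, total)
orderings, each of which makes `G` an ordered `C`-vector space. -/
structure IsIOrdered (C : Type u) [Field C] [LinearOrder C] [AddCommGroup G] [Module C G]
    (lt : I → G → G → Prop) : Prop where
  irrefl : ∀ i x, ¬ lt i x x
  trans : ∀ i x y z, lt i x y → lt i y z → lt i x z
  total : ∀ i x y, lt i x y ∨ x = y ∨ lt i y x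
  add_lt : ∀ i x y z, lt i x y → lt i (x + z) (y + z)
  smul_pos : ∀ i (c : C) x, 0 < c → lt i 0 x → lt i 0 (c • x)

/-- The set `G ∪ {-∞, ∞}`. -/
inductive Ext (G : Type w) : Type w
  | negInf : Ext G
  | of : G → Ext G
  | posInf : Ext G

/-- The extension of an ordering of `G` to `G ∪ {-∞, ∞}` with `-∞ < G < ∞`. -/
def Ext.lt (r : G → G → Prop) : Ext G → Ext G → Prop
  | .negInf, .negInf => False
  | .negInf, _ => True
  | .of x, .of y => r x y
  | .of _, .posInf => True
  | .of _, .negInf => False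
  | .posInf, _ => False

/-- The family of orderings is independent: for distinct indices `i 0, …, i (n - 1)`, nonempty
"formal" intervals `(a k, b k)` in the orderings `i k` with endpoints in `G ∪ {-∞, ∞}` have a
common point. -/
def IsIndependent (lt : I → G → G → Prop) : Prop :=
  ∀ (n : ℕ) (i : Fin n ↪ I) (a b : Fin n → Ext G), (∀ k, Ext.lt (lt (i k)) (a k) (b k)) →
    ∃ s : G, ∀ k, Ext.lt (lt (i k)) (a k) (.of s) ∧ Ext.lt (lt (i k)) (.of s) (b k)

end Spaces

/-! ### The language and the theory -/


/-- Function symbols: `0`, `+`, and scalar multiplication `λ_c` for every `c : C`. -/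
inductive Func (C : Type u) : ℕ → Type u
  | zero : Func C 0
  | add : Func C 2
  | smul (c : C) : Func C 1

/-- Relation symbols: `<_i` for every `i : I`. -/
inductive Rel (I : Type v) : ℕ → Type v
  | lt (i : I) : Rel I 2

/-- The language `{0, +, (λ_c)_{c ∈ C}} ∪ {<_i : i ∈ I}`. -/
def lang (C : Type u) (I : Type v) : FirstOrder.Language.{u, v} := ⟨Func C, Rel I⟩

section Syntax'

variable (C : Type u) (I : Type v) {α : Type w}

/-- The term `0`. -/
def zeroT : (lang C I).Term α := Language.Constants.term (L := lang C I) Func.zero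

variable {C I}

/-- The term `t + s`. -/
def addT (t s : (lang C I).Term α) : (lang C I).Term α :=
  Language.Functions.apply₂ (L := lang C I) Func.add t s

/-- The term `λ_c t`. -/
def smulT (c : C) (t : (lang C I).Term α) : (lang C I).Term α :=
  Language.Functions.apply₁ (L := lang C I) (Func.smul c) t

/-- The formula `t <_i s`. -/
def ltF {n : ℕ} (i : I) (t s : (lang C I).Term (α ⊕ Fin n)) : (lang C I).BoundedFormula α n :=
  Language.Relations.boundedFormula₂ (L := lang C I) (Rel.lt i) t s

end Syntax'

/-- The axioms of the theory of `I`-ordered `C`-vector spaces with independent orderings. -/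
inductive Ax (C : Type u) (I : Type v) [Field C] [LinearOrder C] : Type (max u v)
  | addAssoc
  | addComm
  | addZero
  | addNeg
  | smulAdd (c : C)
  | addSmul (c d : C)
  | mulSmul (c d : C)
  | oneSmul
  | ltIrrefl (i : I)
  | ltTrans (i : I)
  | ltTotal (i : I)
  | addLt (i : I)
  | smulPos (i : I) (c : C) (hc : 0 < c)
  | indep (n : ℕ) (i : Fin n ↪ I) (p q : Fin n → Bool)

section Theory'

open FirstOrder.Language

variable {C : Type u} {I : Type v}

/-- Independence for the distinct indices `i 0, …, i (n - 1)`, the left endpoint of the `k`-th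
interval being `-∞` if `p k` and the `k`-th of `n` universally quantified elements otherwise, the
right endpoint being `∞` if `q k` and the `k`-th of `n` further universally quantified elements
otherwise. -/
noncomputable def indepSentence {n : ℕ} (i : Fin n ↪ I) (p q : Fin n → Bool) :
    (lang C I).Sentence :=
  Formula.iAlls (α := Empty) (β := Fin n ⊕ Fin n)
    ((Formula.iInf fun k : Fin n => if p k ∨ q k then ⊤ else
        ltF (i k) (.var (.inl (.inr (.inl k)))) (.var (.inl (.inr (.inr k))))) |>.imp
      (Formula.iExs (β := Fin 1) (Formula.iInf fun k : Fin n =>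
        (if p k then ⊤ else
          ltF (i k) (.var (.inl (.inl (.inr (.inl k))))) (.var (.inl (.inr 0)))) ⊓
        (if q k then ⊤ else
          ltF (i k) (.var (.inl (.inr 0))) (.var (.inl (.inl (.inr (.inr k)))))))))

variable [Field C] [LinearOrder C]

/-- The sentence expressing an axiom. -/
noncomputable def Ax.sentence : Ax C I → (lang C I).Sentence
  | addAssoc => ∀' ∀' ∀' (addT (addT &0 &1) &2 =' addT &0 (addT &1 &2))
  | addComm => ∀' ∀' (addT &0 &1 =' addT &1 &0)
  | addZero => ∀' (addT &0 (zeroT C I) =' &0)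
  | addNeg => ∀' ∃' (addT &0 &1 =' zeroT C I)
  | smulAdd c => ∀' ∀' (smulT c (addT &0 &1) =' addT (smulT c &0) (smulT c &1))
  | addSmul c d => ∀' (smulT (c + d) &0 =' addT (smulT c &0) (smulT d &0))
  | mulSmul c d => ∀' (smulT (c * d) &0 =' smulT c (smulT d &0))
  | oneSmul => ∀' (smulT 1 &0 =' &0)
  | ltIrrefl i => ∀' ∼ (ltF i &0 &0)
  | ltTrans i => ∀' ∀' ∀' (ltF i &0 &1 ⟹ ltF i &1 &2 ⟹ ltF i &0 &2)
  | ltTotal i => ∀' ∀' (ltF i &0 &1 ⊔ (&0 =' &1) ⊔ ltF i &1 &0)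
  | addLt i => ∀' ∀' ∀' (ltF i &0 &1 ⟹ ltF i (addT &0 &2) (addT &1 &2))
  | smulPos i c _ => ∀' (ltF i (zeroT C I) &0 ⟹ ltF i (zeroT C I) (smulT c &0))
  | indep _ i p q => indepSentence i p q

variable (C I)

/-- The theory whose models are the `I`-ordered `C`-vector spaces with independent orderings. -/
noncomputable def theoryTCI : (lang C I).Theory := Set.range (Ax.sentence (C := C) (I := I))

end Theory'

/-! ### The models of the theory -/

section Models

open FirstOrder.Language

/-- A vector space with a family of binary relations, as a structure for the language. -/
@[reducible] def toStructure (C : Type u) {I : Type v} {G : Type w} [Field C] [AddCommGroup G] [Module C G]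
    (lt : I → G → G → Prop) : (lang C I).Structure G where
  funMap
    | Func.zero, _ => 0
    | Func.add, x => x 0 + x 1
    | Func.smul c, x => c • x 0
  RelMap
    | Rel.lt i, x => lt i (x 0) (x 1)

section Realize

variable {C : Type u} {I : Type v} {M : Type w} [S : (lang C I).Structure M] {α : Type w'}

theorem realize_zeroT (v : α → M) : (zeroT C I).realize v = S.funMap (n := 0) Func.zero ![] :=
  congrArg (S.funMap (n := 0) Func.zero) (Subsingleton.elim _ _)

theorem realize_addT (t s : (lang C I).Term α) (v : α → M) :
    (addT t s).realize v = S.funMap (n := 2) Func.add ![t.realize v, s.realize v] :=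
  Term.realize_functions_apply₂

theorem realize_smulT (c : C) (t : (lang C I).Term α) (v : α → M) :
    (smulT c t).realize v = S.funMap (n := 1) (Func.smul c) ![t.realize v] :=
  Term.realize_functions_apply₁

theorem realize_ltF {n : ℕ} (i : I) (t s : (lang C I).Term (α ⊕ Fin n)) (v : α → M)
    (x : Fin n → M) : (ltF i t s).Realize v x ↔
      S.RelMap (n := 2) (Rel.lt i) ![t.realize (Sum.elim v x), s.realize (Sum.elim v x)] :=
  BoundedFormula.realize_rel₂

theorem realize_indepSentence {n : ℕ} (i : Fin n ↪ I) (p q : Fin n → Bool) :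
    (M ⊨ indepSentence (C := C) i p q) ↔ ∀ a b : Fin n → M,
      (∀ k, p k ∨ q k ∨ S.RelMap (n := 2) (Rel.lt (i k)) ![a k, b k]) →
      ∃ s : M, ∀ k, (p k ∨ S.RelMap (n := 2) (Rel.lt (i k)) ![a k, s]) ∧
        (q k ∨ S.RelMap (n := 2) (Rel.lt (i k)) ![s, b k]) := by
  unfold indepSentence
  rw [Sentence.Realize, Formula.realize_iAlls]
  simp only [Formula.realize_imp, Formula.realize_iExs, Formula.realize_iInf]
  constructor
  · intro h a b hab
    obtain ⟨s, hs⟩ := h (Sum.elim a b) (by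
      intro k
      specialize hab k
      split_ifs with hk
      · exact BoundedFormula.realize_top.2 trivial
      · rw [Formula.Realize, realize_ltF]
        simp only [Term.realize_var, Sum.elim_inl, Sum.elim_inr]
        tauto)
    refine ⟨s 0, fun k => ?_⟩
    specialize hs k
    rw [Formula.Realize, BoundedFormula.realize_inf] at hs
    refine ⟨?_, ?_⟩
    · have := hs.1
      split_ifs at this with hk
      · exact .inl hk
      · rw [realize_ltF] at this
        exact .inr (by simpa using this)
    · have := hs.2
      split_ifs at this with hk
      · exact .inl hk
      · rw [realize_ltF] at this
        exact .inr (by simpa using this)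
  · intro h ab hab
    obtain ⟨s, hs⟩ := h (fun k => ab (.inl k)) (fun k => ab (.inr k)) (by
      intro k
      specialize hab k
      split_ifs at hab with hk
      · tauto
      · rw [Formula.Realize, realize_ltF] at hab
        exact .inr (.inr (by simpa using hab)))
    refine ⟨fun _ => s, fun k => ?_⟩
    specialize hs k
    rw [Formula.Realize, BoundedFormula.realize_inf]
    refine ⟨?_, ?_⟩
    · split_ifs with hk
      · exact BoundedFormula.realize_top.2 trivial
      · rw [realize_ltF]
        simpa using hs.1.resolve_left hk
    · split_ifs with hk
      · exact BoundedFormula.realize_top.2 trivial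
      · rw [realize_ltF]
        simpa using hs.2.resolve_left hk

end Realize

variable {C : Type u} {I : Type v} [Field C] [LinearOrder C]

theorem isIndependent_iff {G : Type w} [Inhabited G] {lt : I → G → G → Prop} :
    IsIndependent lt ↔ ∀ (n : ℕ) (i : Fin n ↪ I) (p q : Fin n → Bool) (a b : Fin n → G),
      (∀ k, p k ∨ q k ∨ lt (i k) (a k) (b k)) →
      ∃ s : G, ∀ k, (p k ∨ lt (i k) (a k) s) ∧ (q k ∨ lt (i k) s (b k)) := by
  constructor
  · intro h n i p q a b hab
    obtain ⟨s, hs⟩ := h n i (fun k => if p k then .negInf else .of (a k))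
      (fun k => if q k then .posInf else .of (b k)) (by
        intro k
        have := hab k
        cases hp : p k <;> cases hq : q k <;> simp_all [Ext.lt])
    refine ⟨s, fun k => ?_⟩
    have := hs k
    cases hp : p k <;> cases hq : q k <;> simp_all [Ext.lt]
  · intro h n i a b hab
    classical
    obtain ⟨s, hs⟩ := h n i (fun k => match a k with | .negInf => true | _ => false)
      (fun k => match b k with | .posInf => true | _ => false)
      (fun k => match a k with | .of x => x | _ => default)
      (fun k => match b k with | .of x => x | _ => default) (by
        intro k
        have := hab k
        cases ha : a k <;> cases hb : b k <;> simp_all [Ext.lt])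
    refine ⟨s, fun k => ?_⟩
    have h1 := hab k
    have h2 := hs k
    cases ha : a k <;> cases hb : b k <;> simp_all [Ext.lt]

/-- The models of `theoryTCI C I` are precisely the `I`-ordered `C`-vector spaces whose family of
orderings is independent. -/
theorem model_theoryTCI_iff {M : Type w} [S : (lang C I).Structure M] :
    (M ⊨ theoryTCI C I) ↔ ∃ (_ : AddCommGroup M) (_ : Module C M) (lt : I → M → M → Prop),
      S = toStructure C lt ∧ IsIOrdered C lt ∧ IsIndependent lt := by
  constructor
  · intro h
    have h (x : Ax C I) : M ⊨ x.sentence := h.realize_of_mem _ ⟨x, rfl⟩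
    have h1 := h .addAssoc
    have h2 := h .addComm
    have h3 := h .addZero
    have h4 := h .addNeg
    have h5 c := h (.smulAdd c)
    have h6 c d := h (.addSmul c d)
    have h7 c d := h (.mulSmul c d)
    have h8 := h .oneSmul
    have h9 i := h (.ltIrrefl i)
    have h10 i := h (.ltTrans i)
    have h11 i := h (.ltTotal i)
    have h12 i := h (.addLt i)
    have h13 i c hc := h (.smulPos i c hc)
    have h14 n i p q := h (.indep n i p q)
    simp [Ax.sentence, Sentence.Realize, Formula.Realize, realize_zeroT, realize_addT,
      realize_smulT, realize_ltF, Fin.snoc] at h1 h2 h3 h4 h5 h6 h7 h8 h9 h10 h11 h12 h13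
    simp only [Ax.sentence, realize_indepSentence] at h14
    choose ng hng using h4
    let zM : M := S.funMap (n := 0) Func.zero ![]
    let aM (x y : M) : M := S.funMap (n := 2) Func.add ![x, y]
    let sM (c : C) (x : M) : M := S.funMap (n := 1) (Func.smul c) ![x]
    let ltM (i : I) (x y : M) : Prop := S.RelMap (n := 2) (Rel.lt i) ![x, y]
    let i0 : Zero M := ⟨zM⟩
    let i1 : Add M := ⟨aM⟩
    let i2 : Neg M := ⟨ng⟩
    let grp : AddCommGroup M :=
      { add := aM
        zero := zM
        neg := ng
        add_assoc := h1
        add_comm := h2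
        zero_add := fun x => (h2 _ _).trans (h3 x)
        add_zero := h3
        neg_add_cancel := fun x => (h2 _ _).trans (hng x)
        nsmul := nsmulRec
        zsmul := zsmulRec }
    let smul : SMul C M := ⟨sM⟩
    have a5 : ∀ (c : C) (x y : M), c • (x + y) = c • x + c • y := h5
    have a6 : ∀ (c d : C) (x : M), (c + d) • x = c • x + d • x := h6
    let mod : Module C M :=
      { smul := sM
        smul_add := a5
        add_smul := a6
        mul_smul := h7
        one_smul := h8
        smul_zero := fun c => by
          have := a5 c 0 0
          rwa [add_zero, left_eq_add] at this
        zero_smul := fun x => by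
          have := a6 0 0 x
          rwa [add_zero, left_eq_add] at this }
    refine ⟨grp, mod, ltM, ?_, ⟨h9, h10, fun i x y => or_assoc.1 (h11 i x y), h12,
      fun i c x hc => h13 i c hc x⟩, ?_⟩
    · refine Structure.ext ?_ ?_
      · funext n f x
        cases f with
        | zero => exact congrArg (S.funMap (n := 0) Func.zero) (Subsingleton.elim _ _)
        | add => exact congrArg (S.funMap (n := 2) Func.add) (by ext k; fin_cases k <;> rfl)
        | smul c =>
          exact congrArg (S.funMap (n := 1) (Func.smul c)) (by ext k; fin_cases k; rfl)
      · funext n r x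
        cases r with
        | lt i => exact congrArg (S.RelMap (n := 2) (Rel.lt i)) (by ext k; fin_cases k <;> rfl)
    · have : Inhabited M := ⟨0⟩
      exact isIndependent_iff.2 h14
  · rintro ⟨_, _, lt, rfl, h, hi⟩
    have : Inhabited M := ⟨0⟩
    let S : (lang C I).Structure M := toStructure C lt
    rw [Theory.model_iff]
    rintro _ ⟨x, rfl⟩
    cases x with
    | indep n i p q => exact (realize_indepSentence i p q).2 (isIndependent_iff.1 hi n i p q)
    | _ =>
      simp [Ax.sentence, Sentence.Realize, Formula.Realize, realize_zeroT, realize_addT,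
        realize_smulT, realize_ltF, Fin.snoc]
      first
      | exact add_assoc
      | exact add_comm
      | exact add_zero
      | exact fun x => ⟨-x, add_neg_cancel x⟩
      | exact smul_add _
      | exact add_smul _ _
      | exact mul_smul _ _
      | exact one_smul C
      | exact h.irrefl _
      | exact h.trans _
      | exact fun x y => or_assoc.2 (h.total _ x y)
      | exact h.add_lt _
      | exact fun x => h.smul_pos _ _ x (by assumption)

end Models

end DistalTCI

/-! The truth of a formula at a tuple depends only on the signs, in each ordering, of linear forms
at that tuple. This is quantifier elimination: after division by coefficients, finitely many sign
conditions on `x` say how `x` lies relative to finitely many roots in finitely many orderings. If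
the roots are ordered alike in a second model, independence there yields a matching `y`
(`exists_sameSign`), and induction on formulas gives `realize_iff_of_sameSign`. Sentences have only
the zero form, so any two models agree.

Distality then becomes a statement about one form `α + x` and one ordering at a time, with `α` from
the parameters and `x` the value of a form along the sequence at `s`. By `exists_move`, `s` can be
moved off `c` to the left as `t` and to the right as `t'`, with `(t, s)` and `(s, t')` of the same
order type. For the corresponding values `y`, `z`, indiscernibility over `∅` gives `y - x` and `x -
z` the same sign, so `x` lies between `y` and `z`. Indiscernibility over `A` off `c` gives `α + y`
and `α + z` the same sign, and by convexity `α + x` shares it.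

Completeness also requires a model. A lexicographic order is pulled back along unitriangular maps
`spread C i`, which can be prescribed simultaneously, for finitely many `i`, up to any level
(`exists_spread_eq`); nonempty lexicographic intervals contain all vectors agreeing with a midpoint
up to some level. -/

namespace DistalTCI

/-! ### Signs in ordered vector spaces -/

section Signs

variable {C : Type u} [Field C] [LinearOrder C] {I : Type v}
  {M : Type w} [AddCommGroup M] [Module C M] {lt : I → M → M → Prop}
  {N : Type w'} [AddCommGroup N] [Module C N] {lt' : I → N → N → Prop}

namespace IsIOrdered

theorem asymm (h : IsIOrdered C lt) {i : I} {x y : M} (hxy : lt i x y) : ¬ lt i y x :=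
  fun hyx => h.irrefl i x (h.trans i x y x hxy hyx)

theorem sub_pos (h : IsIOrdered C lt) {i : I} {x y : M} : lt i 0 (y - x) ↔ lt i x y := by
  constructor
  · intro hxy
    simpa using h.add_lt i 0 (y - x) x hxy
  · intro hxy
    simpa [sub_eq_add_neg] using h.add_lt i x y (-x) hxy

theorem sub_neg (h : IsIOrdered C lt) {i : I} {x y : M} : lt i (x - y) 0 ↔ lt i x y := by
  rw [← h.sub_pos, zero_sub, neg_sub, h.sub_pos]

theorem neg_pos (h : IsIOrdered C lt) {i : I} {x : M} : lt i 0 (-x) ↔ lt i x 0 := by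
  rw [← zero_sub, h.sub_pos]

theorem neg_neg (h : IsIOrdered C lt) {i : I} {x : M} : lt i (-x) 0 ↔ lt i 0 x := by
  rw [← h.neg_pos, _root_.neg_neg]

variable [IsStrictOrderedRing C] in
theorem smul_pos_iff (h : IsIOrdered C lt) {i : I} {c : C} (hc : 0 < c) {x : M} :
    lt i 0 (c • x) ↔ lt i 0 x := by
  refine ⟨fun hx => ?_, h.smul_pos i c x hc⟩
  simpa [smul_smul, hc.ne'] using h.smul_pos i c⁻¹ _ (inv_pos.2 hc) hx

variable [IsStrictOrderedRing C] in
theorem smul_neg_iff (h : IsIOrdered C lt) {i : I} {c : C} (hc : 0 < c) {x : M} :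
    lt i (c • x) 0 ↔ lt i x 0 := by
  rw [← h.neg_pos, ← smul_neg, h.smul_pos_iff hc, h.neg_pos]

/-- The `i`-th ordering as a linear order. -/
@[reducible] noncomputable def linearOrder (h : IsIOrdered C lt) (i : I) : LinearOrder M where
  le x y := x = y ∨ lt i x y
  lt := lt i
  le_refl x := Or.inl rfl
  le_trans x y z := by
    rintro (rfl | hxy) (rfl | hyz)
    · exact Or.inl rfl
    · exact Or.inr hyz
    · exact Or.inr hxy
    · exact Or.inr (h.trans i _ _ _ hxy hyz)
  lt_iff_le_not_ge x y := by
    constructor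
    · intro hxy
      refine ⟨Or.inr hxy, ?_⟩
      rintro (rfl | hyx)
      · exact h.irrefl i _ hxy
      · exact h.asymm hxy hyx
    · rintro ⟨rfl | hxy, hn⟩
      · exact absurd (Or.inl rfl) hn
      · exact hxy
  le_antisymm x y := by
    rintro (rfl | hxy) (h' | hyx)
    · rfl
    · rfl
    · exact h'.symm
    · exact absurd hyx (h.asymm hxy)
  le_total x y := by
    rcases h.total i x y with hxy | rfl | hyx
    · exact Or.inl (Or.inr hxy)
    · exact Or.inl (Or.inl rfl)
    · exact Or.inr (Or.inr hyx)
  toDecidableLE := Classical.decRel _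

/-- A finite set has a least formal lower endpoint for the points above it. -/
theorem exists_lower (h : IsIOrdered C lt) (i : I) (A : Finset M) :
    ∃ a : Ext M, (∀ m, a = .of m → m ∈ A) ∧ a ≠ .posInf ∧
      ∀ x, Ext.lt (lt i) a (.of x) → ∀ y ∈ A, lt i y x := by
  let _ := h.linearOrder i
  rcases A.eq_empty_or_nonempty with rfl | hA
  · exact ⟨.negInf, by simp, by simp, by simp⟩
  · refine ⟨.of (A.max' hA), fun m hm => ?_, by simp, fun x hx y hy => ?_⟩
    · cases hm; exact A.max'_mem hA
    · exact lt_of_le_of_lt (A.le_max' y hy) (show A.max' hA < x from hx)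

/-- A finite set has a greatest formal upper endpoint for the points below it. -/
theorem exists_upper (h : IsIOrdered C lt) (i : I) (A : Finset M) :
    ∃ a : Ext M, (∀ m, a = .of m → m ∈ A) ∧ a ≠ .negInf ∧
      ∀ x, Ext.lt (lt i) (.of x) a → ∀ y ∈ A, lt i x y := by
  let _ := h.linearOrder i
  rcases A.eq_empty_or_nonempty with rfl | hA
  · exact ⟨.posInf, by simp, by simp, by simp⟩
  · refine ⟨.of (A.min' hA), fun m hm => ?_, by simp, fun x hx y hy => ?_⟩
    · cases hm; exact A.min'_mem hA
    · exact lt_of_lt_of_le (show x < A.min' hA from hx) (A.min'_le y hy)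

end IsIOrdered

/-- Only the extreme elements of each finite set matter, so the conditions in one ordering amount to
one formal interval, with an infinite endpoint where a set is empty. -/
theorem IsIndependent.exists_between (hind : IsIndependent lt) (h : IsIOrdered C lt)
    (S : Finset I) (A B : I → Finset M)
    (hAB : ∀ i ∈ S, ∀ x ∈ A i, ∀ y ∈ B i, lt i x y) :
    ∃ s, ∀ i ∈ S, (∀ x ∈ A i, lt i x s) ∧ ∀ y ∈ B i, lt i s y := by
  choose a ha ha' hax using fun i => h.exists_lower i (A i)
  choose b hb hb' hbx using fun i => h.exists_upper i (B i)
  let e : Fin S.card ↪ I := S.equivFin.symm.toEmbedding.trans (Function.Embedding.subtype _)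
  have he : ∀ k, e k ∈ S := fun k => (S.equivFin.symm k).2
  obtain ⟨s, hs⟩ := hind S.card e (fun k => a (e k)) (fun k => b (e k)) (by
    intro k
    have h1 := ha (e k)
    have h2 := ha' (e k)
    have h3 := hb (e k)
    have h4 := hb' (e k)
    cases hak : a (e k) <;> cases hbk : b (e k) <;> simp_all [Ext.lt])
  refine ⟨s, fun i hi => ?_⟩
  obtain ⟨k, rfl⟩ : ∃ k, e k = i := ⟨S.equivFin ⟨i, hi⟩, by simp [e]⟩
  exact ⟨hax _ _ (hs k).1, hbx _ _ (hs k).2⟩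

/-- `x` and `y` have the same sign in the `i`-th orderings of the two spaces. -/
def SameSign (lt : I → M → M → Prop) (lt' : I → N → N → Prop) (i : I) (x : M) (y : N) : Prop :=
  (lt i 0 x ↔ lt' i 0 y) ∧ (lt i x 0 ↔ lt' i y 0)

namespace SameSign

variable {i : I} {x : M} {y : N}

theorem symm (hs : SameSign lt lt' i x y) : SameSign lt' lt i y x :=
  ⟨hs.1.symm, hs.2.symm⟩

theorem trans {P : Type*} [AddCommGroup P] {lt'' : I → P → P → Prop} {z : P}
    (h₁ : SameSign lt lt' i x y) (h₂ : SameSign lt' lt'' i y z) : SameSign lt lt'' i x z :=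
  ⟨h₁.1.trans h₂.1, h₁.2.trans h₂.2⟩

theorem zero (h : IsIOrdered C lt) (h' : IsIOrdered C lt') :
    SameSign lt lt' i 0 0 := by
  simp [SameSign, h.irrefl, h'.irrefl]

theorem of_pos (h : IsIOrdered C lt) (h' : IsIOrdered C lt') (hx : lt i 0 x) (hy : lt' i 0 y) :
    SameSign lt lt' i x y := by
  simp [SameSign, hx, hy, h.asymm hx, h'.asymm hy]

theorem of_neg (h : IsIOrdered C lt) (h' : IsIOrdered C lt') (hx : lt i x 0) (hy : lt' i y 0) :
    SameSign lt lt' i x y := by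
  simp [SameSign, hx, hy, h.asymm hx, h'.asymm hy]

variable [IsStrictOrderedRing C] in
theorem smul (h : IsIOrdered C lt) (h' : IsIOrdered C lt') (hs : SameSign lt lt' i x y) (c : C) :
    SameSign lt lt' i (c • x) (c • y) := by
  rcases lt_trichotomy c 0 with hc | rfl | hc
  · have hc' : 0 < -c := by simpa using hc
    rw [← _root_.neg_neg c, neg_smul, neg_smul (-c) y]
    simp only [SameSign, h.neg_pos, h'.neg_pos, h.neg_neg, h'.neg_neg, h.smul_pos_iff hc',
      h'.smul_pos_iff hc', h.smul_neg_iff hc', h'.smul_neg_iff hc']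
    exact And.symm hs
  · simpa using zero h h'
  · simpa only [SameSign, h.smul_pos_iff hc, h'.smul_pos_iff hc, h.smul_neg_iff hc,
      h'.smul_neg_iff hc] using hs

/-- By totality, zero is what has neither sign. Hence a single ordering already detects equality. -/
theorem eq_zero_iff (h : IsIOrdered C lt) (h' : IsIOrdered C lt') (hs : SameSign lt lt' i x y) :
    x = 0 ↔ y = 0 := by
  constructor
  · rintro rfl
    rcases h'.total i 0 y with hy | hy | hy
    · exact absurd (hs.1.2 hy) (h.irrefl i 0)
    · exact hy.symm
    · exact absurd (hs.2.2 hy) (h.irrefl i 0)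
  · rintro rfl
    rcases h.total i 0 x with hx | hx | hx
    · exact absurd (hs.1.1 hx) (h'.irrefl i 0)
    · exact hx.symm
    · exact absurd (hs.2.1 hx) (h'.irrefl i 0)

end SameSign

end Signs

/-! ### Elimination of one existential quantifier -/

section Elimination

variable {C : Type u} [Field C] [LinearOrder C] [IsStrictOrderedRing C] {I : Type v}
  {M : Type w} [AddCommGroup M] [Module C M] {lt : I → M → M → Prop}
  {N : Type w'} [AddCommGroup N] [Module C N] {lt' : I → N → N → Prop}
  {W : Type*} [AddCommGroup W] [Module C W]

open Classical in
/-- The forms whose signs decide which sign conditions on the forms `c • x + w`,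
`(i, c, w) ∈ F`, are satisfied by some `x`. -/
noncomputable def elimForms (F : Finset (I × C × W)) : Finset (I × W) :=
  F.image (fun p => (p.1, p.2.2)) ∪ (F ×ˢ F ×ˢ F).image
    (fun p => (p.1.1, p.2.1.2.1⁻¹ • p.2.1.2.2 - p.2.2.2.1⁻¹ • p.2.2.2.2))

/-- The form `c • x + e w` with `c ≠ 0` has root `-e (c⁻¹ • w)`. If `x` is a root, the corresponding
root serves as `y`; otherwise `y` must lie in the matching gap between roots in each ordering, and
independence provides it. A root coming from one ordering must be compared with the others in every
ordering, which is why `elimForms` runs over triples. -/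
theorem exists_sameSign (hM : IsIOrdered C lt) (hN : IsIOrdered C lt') (hind : IsIndependent lt')
    (F : Finset (I × C × W)) (e : W →ₗ[C] M) (e' : W →ₗ[C] N)
    (hF : ∀ p ∈ elimForms F, SameSign lt lt' p.1 (e p.2) (e' p.2)) (x : M) :
    ∃ y : N, ∀ p ∈ F, SameSign lt lt' p.1 (p.2.1 • x + e p.2.2) (p.2.1 • y + e' p.2.2) := by
  classical
  have hF1 : ∀ p ∈ F, SameSign lt lt' p.1 (e p.2.2) (e' p.2.2) := fun p hp =>
    hF (p.1, p.2.2) (Finset.mem_union_left _ (Finset.mem_image_of_mem _ hp))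
  have hF2 : ∀ p ∈ F, ∀ q ∈ F, ∀ r ∈ F,
      SameSign lt lt' p.1 (e (q.2.1⁻¹ • q.2.2) - e (r.2.1⁻¹ • r.2.2))
        (e' (q.2.1⁻¹ • q.2.2) - e' (r.2.1⁻¹ • r.2.2)) := by
    intro p hp q hq r hr
    rw [← map_sub, ← map_sub]
    exact hF (p.1, _) (Finset.mem_union_right _ (Finset.mem_image.2
      ⟨(p, q, r), by simp [hp, hq, hr], rfl⟩))
  have key : ∀ y : N, (∀ p ∈ F, p.2.1 ≠ 0 → SameSign lt lt' p.1 (e (p.2.1⁻¹ • p.2.2) + x)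
      (e' (p.2.1⁻¹ • p.2.2) + y)) →
      ∀ p ∈ F, SameSign lt lt' p.1 (p.2.1 • x + e p.2.2) (p.2.1 • y + e' p.2.2) := by
    intro y hy p hp
    by_cases hc : p.2.1 = 0
    · simpa [hc] using hF1 p hp
    · have := (hy p hp hc).smul hM hN p.2.1
      simpa [smul_add, smul_smul, hc, add_comm] using this
  -- For a zero coefficient the convention `0⁻¹ = 0` adds `0` as a spurious root. This is harmless,
  -- since `elimForms` also compares it with the other roots.
  by_cases hx : ∃ q ∈ F, x = - e (q.2.1⁻¹ • q.2.2)
  · obtain ⟨q, hq, rfl⟩ := hx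
    refine ⟨- e' (q.2.1⁻¹ • q.2.2), key _ fun p hp _ => ?_⟩
    simpa only [← sub_eq_add_neg] using hF2 p hp p hp q hq
  · push Not at hx
    obtain ⟨y, hy⟩ := hind.exists_between hN (F.image Prod.fst)
      (fun i => (F.filter fun q => lt i (- e (q.2.1⁻¹ • q.2.2)) x).image
        fun q => - e' (q.2.1⁻¹ • q.2.2))
      (fun i => (F.filter fun q => lt i x (- e (q.2.1⁻¹ • q.2.2))).image
        fun q => - e' (q.2.1⁻¹ • q.2.2)) (by
      intro i hi a ha b hb
      obtain ⟨p, hp, rfl⟩ := Finset.mem_image.1 hi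
      obtain ⟨q, hq, rfl⟩ := Finset.mem_image.1 ha
      obtain ⟨r, hr, rfl⟩ := Finset.mem_image.1 hb
      rw [Finset.mem_filter] at hq hr
      have h1 := hM.sub_pos.2 (hM.trans _ _ _ _ hq.2 hr.2)
      rw [neg_sub_neg] at h1
      rw [← hN.sub_pos, neg_sub_neg]
      exact (hF2 p hp q hq.1 r hr.1).1.1 h1)
    refine ⟨y, key y fun p hp _ => ?_⟩
    obtain ⟨hy1, hy2⟩ := hy p.1 (Finset.mem_image_of_mem _ hp)
    rcases hM.total p.1 (- e (p.2.1⁻¹ • p.2.2)) x with hlt | heq | hlt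
    · have := hy1 _ (Finset.mem_image_of_mem _ (Finset.mem_filter.2 ⟨hp, hlt⟩))
      rw [← hM.sub_pos, sub_neg_eq_add, add_comm] at hlt
      rw [← hN.sub_pos, sub_neg_eq_add, add_comm] at this
      exact SameSign.of_pos hM hN hlt this
    · exact absurd heq.symm (hx p hp)
    · have := hy2 _ (Finset.mem_image_of_mem _ (Finset.mem_filter.2 ⟨hp, hlt⟩))
      rw [← hM.sub_neg, sub_neg_eq_add, add_comm] at hlt
      rw [← hN.sub_neg, sub_neg_eq_add, add_comm] at this
      exact SameSign.of_neg hM hN hlt this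

end Elimination

/-! ### Signs of linear forms determine the truth of formulas -/

section Formulas

open FirstOrder.Language

variable {C : Type u} [Field C] {I : Type v} {α : Type*}

/-- The value of a linear form in free variables from `α` and `n` bound variables. -/
noncomputable def evalForm {M : Type w} [AddCommGroup M] [Module C M] {n : ℕ} (v : α → M)
    (xs : Fin n → M) : ((α →₀ C) × (Fin n → C)) →ₗ[C] M :=
  (Finsupp.linearCombination C v).coprod (Fintype.linearCombination C xs)

/-- Isolates the last bound variable, giving the shape to which `exists_sameSign` applies. -/
theorem evalForm_snoc {M : Type w} [AddCommGroup M] [Module C M] {n : ℕ} (v : α → M)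
    (xs : Fin n → M) (x : M) (f : α →₀ C) (g : Fin (n + 1) → C) :
    evalForm v (Fin.snoc xs x) (f, g) =
      g (Fin.last n) • x + evalForm v xs (f, fun k => g k.castSucc) := by
  simp [evalForm, Fintype.linearCombination_apply, Fin.sum_univ_castSucc]
  abel

/-- The linear form defined by a term. -/
noncomputable def linForm {n : ℕ} : (lang C I).Term (α ⊕ Fin n) → (α →₀ C) × (Fin n → C)
  | .var (.inl a) => (Finsupp.single a 1, 0)
  | .var (.inr k) => (0, Pi.single k 1)
  | .func Func.zero _ => 0
  | .func Func.add ts => linForm (ts 0) + linForm (ts 1)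
  | .func (Func.smul c) ts => c • linForm (ts 0)

theorem realize_eq_evalForm {M : Type w} [S : (lang C I).Structure M] [AddCommGroup M]
    [Module C M] {lt : I → M → M → Prop} (hS : S = toStructure C lt) {n : ℕ} (v : α → M)
    (xs : Fin n → M) (t : (lang C I).Term (α ⊕ Fin n)) :
    t.realize (Sum.elim v xs) = evalForm v xs (linForm t) := by
  subst hS
  induction t with
  | var a => cases a <;> simp [linForm, evalForm, Fintype.linearCombination_apply, Pi.single_apply]
  | func f ts ih =>
    cases f with
    | zero => simp [linForm, Term.realize, Structure.funMap]
    | add => simp [linForm, Term.realize, Structure.funMap, ih]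
    | smul c => simp [linForm, Term.realize, Structure.funMap, ih]

/-- Every linear form is defined by a term. -/
theorem exists_term (f : α →₀ C) : ∃ t : (lang C I).Term α, ∀ (M : Type w) [AddCommGroup M]
    [Module C M] (lt : I → M → M → Prop) (v : α → M),
    letI := toStructure C lt
    t.realize v = Finsupp.linearCombination C v f := by
  induction f using Finsupp.induction_linear with
  | zero =>
    refine ⟨zeroT C I, fun M _ _ lt v => ?_⟩
    let _ := toStructure C lt
    rw [realize_zeroT]
    simp [Structure.funMap]
  | add f g hf hg =>
    obtain ⟨t, ht⟩ := hf
    obtain ⟨s, hs⟩ := hg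
    refine ⟨addT t s, fun M _ _ lt v => ?_⟩
    let _ := toStructure C lt
    rw [realize_addT, map_add, ← ht M lt v, ← hs M lt v]
    rfl
  | single a c =>
    refine ⟨smulT c (.var a), fun M _ _ lt v => ?_⟩
    let _ := toStructure C lt
    rw [realize_smulT]
    simp [Structure.funMap]

variable [LinearOrder C] [IsStrictOrderedRing C]
  {M : Type w} [S : (lang C I).Structure M] [AddCommGroup M] [Module C M] {lt : I → M → M → Prop}
  {N : Type w'} [S' : (lang C I).Structure N] [AddCommGroup N] [Module C N] {lt' : I → N → N → Prop}

theorem exists_finset_forms [Nonempty I] (hS : S = toStructure C lt) (hS' : S' = toStructure C lt')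
    (hM : IsIOrdered C lt) (hN : IsIOrdered C lt') (hMi : IsIndependent lt)
    (hNi : IsIndependent lt') {n : ℕ} (φ : (lang C I).BoundedFormula α n) :
    ∃ F : Finset (I × ((α →₀ C) × (Fin n → C))), ∀ (v : α → M) (xs : Fin n → M) (v' : α → N)
      (xs' : Fin n → N),
      (∀ p ∈ F, SameSign lt lt' p.1 (evalForm v xs p.2) (evalForm v' xs' p.2)) →
      (φ.Realize v xs ↔ φ.Realize v' xs') := by
  classical
  induction φ with
  | falsum => exact ⟨∅, by simp [BoundedFormula.Realize]⟩
  | equal t₁ t₂ =>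
    -- An equation is tested by the sign of the difference in an arbitrary ordering; this is where
    -- `I` must be nonempty.
    obtain ⟨i⟩ := ‹Nonempty I›
    refine ⟨{(i, linForm t₁ - linForm t₂)}, fun v xs v' xs' h => ?_⟩
    have := (h _ (Finset.mem_singleton_self _)).eq_zero_iff hM hN
    simpa only [BoundedFormula.Realize, realize_eq_evalForm hS, realize_eq_evalForm hS', map_sub,
      sub_eq_zero] using this
  | rel R ts =>
    cases R with
    | lt i =>
      refine ⟨{(i, linForm (ts 1) - linForm (ts 0))}, fun v xs v' xs' h => ?_⟩
      have := (h _ (Finset.mem_singleton_self _)).1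
      simp only [map_sub, hM.sub_pos, hN.sub_pos] at this
      simp only [BoundedFormula.Realize, realize_eq_evalForm hS, realize_eq_evalForm hS']
      subst hS hS'
      exact this
  | imp φ ψ ihφ ihψ =>
    obtain ⟨F, hF⟩ := ihφ
    obtain ⟨F', hF'⟩ := ihψ
    refine ⟨F ∪ F', fun v xs v' xs' h => ?_⟩
    rw [BoundedFormula.realize_imp, BoundedFormula.realize_imp,
      hF v xs v' xs' fun p hp => h p (Finset.mem_union_left _ hp),
      hF' v xs v' xs' fun p hp => h p (Finset.mem_union_right _ hp)]
  | @all n φ ih =>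
    obtain ⟨F, hF⟩ := ih
    let F' : Finset (I × C × ((α →₀ C) × (Fin n → C))) :=
      F.image fun p => (p.1, p.2.2 (Fin.last n), p.2.1, fun k => p.2.2 k.castSucc)
    refine ⟨elimForms F', fun v xs v' xs' h => ?_⟩
    rw [BoundedFormula.realize_all, BoundedFormula.realize_all]
    constructor
    -- A value in the second model is carried back to the first, and conversely below, so
    -- independence is used in both models.
    · intro hφ y
      obtain ⟨x, hx⟩ := exists_sameSign hN hM hMi F' (evalForm v' xs') (evalForm v xs)
        (fun p hp => (h p hp).symm) y
      refine (hF v (Fin.snoc xs x) v' (Fin.snoc xs' y) fun p hp => ?_).1 (hφ x)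
      rw [evalForm_snoc, evalForm_snoc]
      exact (hx _ (Finset.mem_image_of_mem _ hp)).symm
    · intro hφ x
      obtain ⟨y, hy⟩ := exists_sameSign hM hN hNi F' (evalForm v xs) (evalForm v' xs') h x
      refine (hF v (Fin.snoc xs x) v' (Fin.snoc xs' y) fun p hp => ?_).2 (hφ y)
      rw [evalForm_snoc, evalForm_snoc]
      exact hy _ (Finset.mem_image_of_mem _ hp)

/-- Tuples at which all linear forms have the same signs satisfy the same formulas. -/
theorem realize_iff_of_sameSign [Nonempty I] (hS : S = toStructure C lt)
    (hS' : S' = toStructure C lt') (hM : IsIOrdered C lt) (hN : IsIOrdered C lt')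
    (hMi : IsIndependent lt) (hNi : IsIndependent lt') (φ : (lang C I).Formula α)
    {v : α → M} {v' : α → N}
    (h : ∀ i (f : α →₀ C), SameSign lt lt' i (Finsupp.linearCombination C v f)
      (Finsupp.linearCombination C v' f)) : φ.Realize v ↔ φ.Realize v' := by
  obtain ⟨F, hF⟩ := exists_finset_forms hS hS' hM hN hMi hNi φ
  refine hF v default v' default fun p _ => ?_
  simpa [evalForm, Fintype.linearCombination_apply] using h p.1 p.2.1

end Formulas

/-! ### Indiscernible sequences -/

section IndiscernibleSequences

open FirstOrder.Language

/-- Indices may repeat or come out of order: enumerate the image of `p` increasingly and relabel the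
variables accordingly. -/
theorem Indiscernible.realize_iff_of_finite {L : FirstOrder.Language.{u, v}} {M : Type w}
    [L.Structure M] {A : Set M} {J : Type w'} [LinearOrder J] {n : ℕ} {a : J → Fin n → M}
    (ha : Indiscernible L A a) {X : Type*} [Finite X] {p q : X → J}
    (hpq : ∀ x y, p x < p y ↔ q x < q y) (φ : L[[A]].Formula (X × Fin n)) :
    φ.Realize (fun z => a (p z.1) z.2) ↔ φ.Realize (fun z => a (q z.1) z.2) := by
  classical
  cases nonempty_fintype X
  let e := (Finset.univ.image p).orderIsoOfFin rfl
  have hp : ∀ x, p x ∈ Finset.univ.image p := fun x => Finset.mem_image_of_mem _ (Finset.mem_univ x)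
  let r : X → Fin (Finset.univ.image p).card := fun x => e.symm ⟨p x, hp x⟩
  have hr : ∀ x, (e (r x) : J) = p x := fun x => by simp [r]
  have hsurj : ∀ m, ∃ x, r x = m := by
    intro m
    obtain ⟨x, -, hx⟩ := Finset.mem_image.1 (e m).2
    refine ⟨x, e.injective (Subtype.ext ?_)⟩
    rw [hr, hx]
  choose g hg using hsurj
  have heg : ∀ m, (e m : J) = p (g m) := fun m => by rw [← hr, hg]
  -- Equality is incomparability in a linear order, so indices identified by `p` are identified by
  -- `q`.
  have hq : ∀ x, q (g (r x)) = q x := by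
    intro x
    have h : p (g (r x)) = p x := by rw [← heg, hr]
    refine le_antisymm (not_lt.1 fun h' => ?_) (not_lt.1 fun h' => ?_)
    · exact absurd ((hpq _ _).2 h') (by simp [h])
    · exact absurd ((hpq _ _).2 h') (by simp [h])
  have := ha _ (φ.relabel (Prod.map r id)) (fun m => (e m : J)) (fun m => q (g m))
    (fun m m' h => e.strictMono h) (fun m m' h => by
      rw [← hpq, ← heg, ← heg]
      exact e.strictMono h)
  rw [Formula.realize_relabel, Formula.realize_relabel] at this
  simpa [Function.comp_def, hr, hq] using this

theorem exists_strictMono_of_infinite {J : Type*} [LinearOrder J] {Q : Set J} (hQ : Q.Infinite)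
    (k : ℕ) : ∃ e : Fin k → J, StrictMono e ∧ ∀ m, e m ∈ Q := by
  obtain ⟨t, htQ, htk⟩ := hQ.exists_subset_card_eq k
  exact ⟨t.orderEmbOfFin htk, (t.orderEmbOfFin htk).strictMono,
    fun m => htQ (t.orderEmbOfFin_mem htk m)⟩

/-- An infinite set contains an infinite subset lying in one gap of a given finite family. -/
theorem exists_infinite_gap {J : Type*} [LinearOrder J] {Q : Set J} (hQ : Q.Infinite)
    {X : Type*} [Finite X] (s : X → J) :
    ∃ (D : Set X) (R : Set J), R.Infinite ∧ R ⊆ Q ∧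
      ∀ j ∈ R, ∀ m, (m ∈ D → s m < j) ∧ (m ∉ D → j < s m) := by
  have hQ' : (Q \ Set.range s).Infinite := hQ.sdiff (Set.finite_range s)
  have := hQ'.to_subtype
  -- Pigeonhole: there are finitely many subsets of `X`, so infinitely many `j` have the same set of
  -- points `s m` below them.
  obtain ⟨D, hD⟩ := Finite.exists_infinite_fiber
    (fun j : ↥(Q \ Set.range s) => {m | s m < (j : J)})
  refine ⟨D, _, (Set.infinite_coe_iff.1 hD).image Subtype.val_injective.injOn, ?_, ?_⟩
  · rintro _ ⟨j, -, rfl⟩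
    exact j.2.1
  · rintro _ ⟨j, rfl, rfl⟩ m
    refine ⟨fun hm => hm, fun hm => lt_of_le_of_ne (not_lt.1 hm) ?_⟩
    rintro h
    exact j.2.2 ⟨m, h.symm⟩

/-- A finite increasing sequence can be moved off the point `c` in two ways, `t` and `t'`, so that
the pairs `(t, s)` and `(s, t')` have the same order type. -/
theorem exists_move {J : Type*} [LinearOrder J] {c : J} (h₁ : (Set.Iio c).Infinite)
    (h₂ : (Set.Ioi c).Infinite) {k : ℕ} {s : Fin k → J} (hs : StrictMono s) :
    ∃ t t' : Fin k → J, StrictMono t ∧ StrictMono t' ∧ (∀ m, t m ≠ c) ∧ (∀ m, t' m ≠ c) ∧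
      ∀ x y : Fin k ⊕ Fin k, Sum.elim t s x < Sum.elim t s y ↔
        Sum.elim s t' x < Sum.elim s t' y := by
  classical
  obtain ⟨D₁, R₁, hR₁, hRc₁, hD₁⟩ := exists_infinite_gap h₁ s
  obtain ⟨D₂, R₂, hR₂, hRc₂, hD₂⟩ := exists_infinite_gap h₂ s
  obtain ⟨e₁, he₁, heR₁⟩ := exists_strictMono_of_infinite hR₁ k
  obtain ⟨e₂, he₂, heR₂⟩ := exists_strictMono_of_infinite hR₂ k
  have A1 : ∀ m m', m ∈ D₁ → s m < e₁ m' := fun m m' hm => (hD₁ _ (heR₁ m') m).1 hm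
  have A2 : ∀ m m', m ∉ D₁ → e₁ m' < s m := fun m m' hm => (hD₁ _ (heR₁ m') m).2 hm
  have B1 : ∀ m m', m ∈ D₂ → s m < e₂ m' := fun m m' hm => (hD₂ _ (heR₂ m') m).1 hm
  have B2 : ∀ m m', m ∉ D₂ → e₂ m' < s m := fun m m' hm => (hD₂ _ (heR₂ m') m).2 hm
  have C1 : ∀ m, e₁ m < c := fun m => hRc₁ (heR₁ m)
  have C2 : ∀ m, c < e₂ m := fun m => hRc₂ (heR₂ m)
  have S : ∀ m m', s m < s m' ↔ m < m' := fun m m' => hs.lt_iff_lt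
  have E1 : ∀ m m', e₁ m < e₁ m' ↔ m < m' := fun m m' => he₁.lt_iff_lt
  have E2 : ∀ m m', e₂ m < e₂ m' ↔ m < m' := fun m m' => he₂.lt_iff_lt
  -- The gap found on a side of `c` need not be adjacent to `c`, so the whole block of `s` between
  -- the two gaps is moved. An index with `s m = c` belongs to that block. On it `e₁ < s < e₂`, with
  -- no other point of `s` intervening.
  let t : Fin k → J := fun m => if m ∉ D₁ ∧ m ∈ D₂ then e₁ m else s m
  let t' : Fin k → J := fun m => if m ∉ D₁ ∧ m ∈ D₂ then e₂ m else s m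
  have T : ∀ x y : Fin k ⊕ Fin k, Sum.elim t s x < Sum.elim t s y ↔
      Sum.elim s t' x < Sum.elim s t' y := by
    rintro (m | m) (m' | m') <;> simp only [Sum.elim_inl, Sum.elim_inr, t, t'] <;> grind
  refine ⟨t, t', ?_, ?_, ?_, ?_, T⟩
  · intro m m' h
    exact (T (.inl m) (.inl m')).2 (hs h)
  · intro m m' h
    exact (T (.inr m) (.inr m')).1 (hs h)
  · intro m
    simp only [t]
    grind [A1 m m, A2 m m, B1 m m, B2 m m]
  · intro m
    simp only [t']
    grind [A1 m m, A2 m m, B1 m m, B2 m m]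

end IndiscernibleSequences

/-! ### Distality -/

section DistalityOfModels

open FirstOrder.Language

theorem exists_eq_mapDomain_add_mapDomain {C : Type u} [Field C] {α β : Type*} (f : α ⊕ β →₀ C) :
    ∃ (g : α →₀ C) (h : β →₀ C), f = g.mapDomain .inl + h.mapDomain .inr := by
  induction f using Finsupp.induction_linear with
  | zero => exact ⟨0, 0, by simp⟩
  | add f f' hf hf' =>
    obtain ⟨g, h, rfl⟩ := hf
    obtain ⟨g', h', rfl⟩ := hf'
    refine ⟨g + g', h + h', ?_⟩
    rw [Finsupp.mapDomain_add, Finsupp.mapDomain_add]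
    abel
  | single x c =>
    rcases x with a | b
    · exact ⟨Finsupp.single a c, 0, by simp⟩
    · exact ⟨0, Finsupp.single b c, by simp⟩

variable {C : Type u} [Field C] [LinearOrder C] {I : Type v}
  {M : Type w} [S : (lang C I).Structure M] [AddCommGroup M] [Module C M] {lt : I → M → M → Prop}

/-- Positivity of a form is one atomic formula, whose variables from `A` become parameters;
negativity is positivity of `-f`. -/
theorem Indiscernible.sameSign (hS : S = toStructure C lt) (hM : IsIOrdered C lt) {A : Set M}
    {J : Type w'} [LinearOrder J] {n : ℕ} {a : J → Fin n → M}
    (ha : Indiscernible (lang C I) A a) {X : Type*} [Finite X] {p q : X → J}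
    (hpq : ∀ x y, p x < p y ↔ q x < q y) (i : I) (f : A ⊕ (X × Fin n) →₀ C) :
    SameSign lt lt i (Finsupp.linearCombination C (Sum.elim (↑) fun z => a (p z.1) z.2) f)
      (Finsupp.linearCombination C (Sum.elim (↑) fun z => a (q z.1) z.2) f) := by
  have key : ∀ f : A ⊕ (X × Fin n) →₀ C,
      lt i 0 (Finsupp.linearCombination C (Sum.elim (↑) fun z => a (p z.1) z.2) f) ↔
        lt i 0 (Finsupp.linearCombination C (Sum.elim (↑) fun z => a (q z.1) z.2) f) := by
    intro f
    obtain ⟨t, ht⟩ := exists_term (I := I) f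
    let ψ : (lang C I).BoundedFormula (A ⊕ (X × Fin n)) 0 :=
      ltF i (zeroT C I) (t.relabel .inl)
    have h1 := ha.realize_iff_of_finite hpq (BoundedFormula.constantsVarsEquiv.symm ψ)
    have h2 : ∀ r : X × Fin n → M,
        Formula.Realize (BoundedFormula.constantsVarsEquiv.symm ψ : (lang C I)[[A]].Formula _) r ↔
          lt i 0 (Finsupp.linearCombination C (Sum.elim (↑) r) f) := by
      intro r
      rw [Formula.Realize, ← BoundedFormula.realize_constantsVarsEquiv, Equiv.apply_symm_apply,
        realize_ltF, Term.realize_relabel, realize_zeroT]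
      subst hS
      simp only [coe_con, Sum.elim_comp_inl]
      exact iff_of_eq (congrArg (lt i 0) (ht M lt _))
    rwa [h2, h2] at h1
  refine ⟨key f, ?_⟩
  have := key (-f)
  rwa [map_neg, map_neg, hM.neg_pos, hM.neg_pos] at this

theorem distalIn_of_eq [IsStrictOrderedRing C] [Nonempty I] (hS : S = toStructure C lt) (hM : IsIOrdered C lt)
    (hMi : IsIndependent lt) : DistalIn.{u, v, w, w'} (lang C I) M := by
  intro A n J _ c a h₁ h₂ ha hc k φ s t hs ht
  have off : ∀ {s t : Fin k → J}, StrictMono s → StrictMono t → (∀ m, s m ≠ c) → (∀ m, t m ≠ c) →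
      ∀ (i : I) (f : A ⊕ (Fin k × Fin n) →₀ C),
      SameSign lt lt i (Finsupp.linearCombination C (Sum.elim (↑) fun z => a (s z.1) z.2) f)
        (Finsupp.linearCombination C (Sum.elim (↑) fun z => a (t z.1) z.2) f) := by
    intro s t hs ht hsc htc i f
    exact Indiscernible.sameSign hS hM hc (p := fun m => ⟨s m, hsc m⟩) (q := fun m => ⟨t m, htc m⟩)
      (fun x y => by simp [hs.lt_iff_lt, ht.lt_iff_lt]) i f
  have move : ∀ {s : Fin k → J}, StrictMono s → ∃ t : Fin k → J, StrictMono t ∧ (∀ m, t m ≠ c) ∧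
      ∀ (i : I) (f : A ⊕ (Fin k × Fin n) →₀ C),
      SameSign lt lt i (Finsupp.linearCombination C (Sum.elim (↑) fun z => a (s z.1) z.2) f)
        (Finsupp.linearCombination C (Sum.elim (↑) fun z => a (t z.1) z.2) f) := by
    intro s hs
    obtain ⟨t, t', ht, ht', htc, htc', hst⟩ := exists_move h₁ h₂ hs
    refine ⟨t, ht, htc, fun i f => ?_⟩
    have h3 := off ht ht' htc htc' i f
    obtain ⟨g, h, rfl⟩ := exists_eq_mapDomain_add_mapDomain f
    -- The form "left block minus right block" is evaluated at `(t, s)` and at `(s, t')`. It does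
    -- not involve `A`, so indiscernibility over `∅` suffices.
    have h4 := ha.sameSign hS hM hst i
      (h.mapDomain (fun z => .inr (.inl z.1, z.2)) - h.mapDomain (fun z => .inr (.inr z.1, z.2)))
    simp only [map_add, map_sub, Finsupp.linearCombination_mapDomain] at h3 h4 ⊢
    simp only [Function.comp_def, Sum.elim_inl, Sum.elim_inr] at h3 h4 ⊢
    generalize Finsupp.linearCombination C (fun x : A => (x : M)) g = α at *
    generalize Finsupp.linearCombination C (fun z : Fin k × Fin n => a (s z.1) z.2) h = x at *
    generalize Finsupp.linearCombination C (fun z : Fin k × Fin n => a (t z.1) z.2) h = y at *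
    generalize Finsupp.linearCombination C (fun z : Fin k × Fin n => a (t' z.1) z.2) h = z at *
    have h5 := h4.eq_zero_iff hM hM
    unfold SameSign at h3 h4 ⊢
    simp only [hM.sub_pos, hM.sub_neg, sub_eq_zero] at h4 h5
    have shift : ∀ {b d}, lt i b d → lt i (α + b) (α + d) := fun hbd => by
      simpa only [add_comm α] using hM.add_lt i _ _ α hbd
    have tr := hM.trans i
    -- Either `z < x < y`, or `x = y`, or `y < x < z`. After translation by `α`, convexity transfers
    -- the common sign of the outer values to the middle one.
    rcases hM.total i x y with hxy | rfl | hxy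
    · have hzx := shift (h4.1.1 hxy)
      have hxy := shift hxy
      exact ⟨⟨fun h => tr _ _ _ h hxy, fun h => tr _ _ _ (h3.1.1 h) hzx⟩,
        ⟨fun h => h3.2.2 (tr _ _ _ hzx h), fun h => tr _ _ _ hxy h⟩⟩
    · exact ⟨Iff.rfl, Iff.rfl⟩
    · have hzx := shift (h4.2.1 hxy)
      have hxy := shift hxy
      exact ⟨⟨fun h => h3.1.2 (tr _ _ _ h hzx), fun h => tr _ _ _ h hxy⟩,
        ⟨fun h => tr _ _ _ hxy h, fun h => tr _ _ _ hzx (h3.2.1 h)⟩⟩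
  obtain ⟨s', hs', hsc', hss'⟩ := move hs
  obtain ⟨t', ht', htc', htt'⟩ := move ht
  rw [Formula.Realize, Formula.Realize, ← BoundedFormula.realize_constantsVarsEquiv,
    ← BoundedFormula.realize_constantsVarsEquiv]
  refine realize_iff_of_sameSign hS hS hM hM hMi hMi _ fun i f => ?_
  simp only [coe_con]
  exact ((hss' i f).trans (off hs' ht' hsc' htc' i f)).trans (htt' i f).symm

end DistalityOfModels

/-! ### Existence of an independent family of orderings -/

section Independence

variable {C : Type u} [Field C] [LinearOrder C] {I : Type v} {M : Type w} [AddCommGroup M]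
  [Module C M] {lt : I → M → M → Prop}

theorem IsIOrdered.exists_pos [Nontrivial M] (h : IsIOrdered C lt) (i : I) : ∃ e, lt i 0 e := by
  obtain ⟨x, hx⟩ := exists_ne (0 : M)
  rcases h.total i 0 x with hx' | hx' | hx'
  · exact ⟨x, hx'⟩
  · exact absurd hx'.symm hx
  · exact ⟨-x, h.neg_pos.2 hx'⟩

/-- In the definition of independence intervals with endpoints in the space suffice. -/
theorem IsIOrdered.isIndependent_of_forall [Nontrivial M] (h : IsIOrdered C lt)
    (H : ∀ (n : ℕ) (i : Fin n ↪ I) (a b : Fin n → M), (∀ k, lt (i k) (a k) (b k)) →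
      ∃ s, ∀ k, lt (i k) (a k) s ∧ lt (i k) s (b k)) : IsIndependent lt := by
  intro n i a b hab
  have red : ∀ k, ∃ a' b' : M, lt (i k) a' b' ∧ ∀ s, lt (i k) a' s → lt (i k) s b' →
      Ext.lt (lt (i k)) (a k) (.of s) ∧ Ext.lt (lt (i k)) (.of s) (b k) := by
    intro k
    obtain ⟨e, he⟩ := h.exists_pos (i k)
    have hk := hab k
    generalize a k = a at hk
    generalize b k = b at hk
    cases a with
    | negInf =>
      cases b with
      | negInf => exact hk.elim
      | of y => exact ⟨y - e, y, h.sub_pos.1 (by simpa using he), fun s _ hs => ⟨trivial, hs⟩⟩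
      | posInf => exact ⟨0, e, he, fun _ _ _ => ⟨trivial, trivial⟩⟩
    | of x =>
      cases b with
      | negInf => exact hk.elim
      | of y => exact ⟨x, y, hk, fun s hs hs' => ⟨hs, hs'⟩⟩
      | posInf => exact ⟨x, x + e, h.sub_pos.1 (by simpa using he), fun s hs _ => ⟨hs, trivial⟩⟩
    | posInf => exact hk.elim
  choose a' b' hab' hs' using red
  obtain ⟨s, hs⟩ := H n i a' b' hab'
  exact ⟨s, fun k => hs' k s (hs k).1 (hs k).2⟩

end Independence

/-! ### An explicit model: finitely supported functions on lists -/

section Existence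

variable {I : Type v}

/-- The level of a list of labelled natural numbers. -/
def level : List (ℕ × I) → ℕ
  | [] => 0
  | p :: y => p.1 + 1 + level y

open Classical in
/-- A linear ordering of the lists that refines the ordering by level. -/
@[reducible] noncomputable def levelOrder (I : Type v) : LinearOrder (List (ℕ × I)) :=
  letI : LinearOrder (List (ℕ × I)) := linearOrderOfSTO WellOrderingRel
  LinearOrder.lift' (fun y => toLex (level y, y)) fun _ _ h =>
    congrArg (fun z => (ofLex z).2) h

open Classical in
theorem levelOrder_lt {x y : List (ℕ × I)} (h : level x < level y) : (levelOrder I).lt x y := by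
  let _ : LinearOrder (List (ℕ × I)) := linearOrderOfSTO WellOrderingRel
  exact Prod.Lex.lt_iff.2 (Or.inl h)

attribute [local instance] levelOrder

variable {C : Type u} [Field C]

open Classical in
/-- The image of a basis vector under `spread`. -/
noncomputable def spreadBasis (C : Type u) [Field C] (i : I) : List (ℕ × I) → List (ℕ × I) →₀ C
  | [] => .single [] 1
  | p :: y => .single (p :: y) 1 + if p.2 = i then .single y 1 else 0

/-- The unitriangular map that sends the basis vector at `(l, i) :: y` to its sum with the basis
vector at `y` and fixes the other basis vectors. -/
noncomputable def spread (C : Type u) [Field C] (i : I) :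
    (List (ℕ × I) →₀ C) →ₗ[C] (List (ℕ × I) →₀ C) :=
  Finsupp.linearCombination C (spreadBasis C i)

theorem spreadBasis_self (i : I) (x : List (ℕ × I)) : spreadBasis C i x x = 1 := by
  cases x with
  | nil => simp [spreadBasis]
  | cons p y =>
    simp only [spreadBasis]
    split_ifs <;> simp

/-- The only other list that can occur in the image of `x` is its tail, whose level is strictly
smaller because of the `+ 1` in `level`. -/
theorem spreadBasis_of_ne (i : I) {x y : List (ℕ × I)} (hxy : x ≠ y) (h : level x ≤ level y) :
    spreadBasis C i x y = 0 := by
  cases x with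
  | nil => simp [spreadBasis, hxy]
  | cons p z =>
    have hz : z ≠ y := by
      rintro rfl
      simp only [level] at h
      omega
    simp only [spreadBasis]
    split_ifs <;> simp [hxy, hz]

/-- By triangularity, the coefficient at a point of maximal level in the support is unchanged. -/
theorem spread_injective (i : I) : Function.Injective (spread C i) := by
  rw [injective_iff_map_eq_zero]
  intro f hf
  by_contra hf0
  obtain ⟨y, hy, hmax⟩ := f.support.exists_max_image level (Finsupp.support_nonempty_iff.2 hf0)
  have h := DFunLike.congr_fun hf y
  rw [spread, Finsupp.linearCombination_apply, Finsupp.sum, Finsupp.finsetSum_apply,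
    Finset.sum_eq_single y] at h
  · simp only [Finsupp.smul_apply, spreadBasis_self, smul_eq_mul, mul_one] at h
    exact Finsupp.mem_support_iff.1 hy h
  · intro x hx hxy
    rw [Finsupp.smul_apply, spreadBasis_of_ne i hxy (hmax x hx), smul_zero]
  · exact fun hy' => absurd hy hy'

/-- Simultaneous approximation up to a given level. -/
theorem exists_spread_eq {n : ℕ} (i : Fin n ↪ I) (p : Fin n → List (ℕ × I) →₀ C) (N : ℕ) :
    ∃ s, ∀ k y, level y ≤ N → spread C (i k) s y = p k y := by
  classical
  -- Prefixing `(N, i k)` pushes a copy of `p k` above level `N`. There it is invisible itself, but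
  -- `spread C (i k)` adds back the original `p k`, and no other copy contributes because the labels
  -- are distinct.
  refine ⟨∑ k, (p k).mapDomain (fun z => (N, i k) :: z), fun k y hy => ?_⟩
  have h : ∀ k', spread C (i k) ((p k').mapDomain fun z => (N, i k') :: z) y =
      if k' = k then p k y else 0 := by
    intro k'
    have hne : ∀ z, (N, i k') :: z ≠ y := by
      rintro z rfl
      simp only [level] at hy
      omega
    rw [spread, Finsupp.linearCombination_mapDomain, Finsupp.linearCombination_apply, Finsupp.sum,
      Finsupp.finsetSum_apply]
    simp only [Function.comp_apply, spreadBasis, i.injective.eq_iff]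
    split_ifs with hk
    · subst hk
      simp [Finsupp.single_apply, hne, eq_comm]
    · simp [hne]
  rw [map_sum, Finsupp.finsetSum_apply, Finset.sum_congr rfl fun k' _ => h k']
  simp

variable [LinearOrder C]

/-- The orderings of the space of finitely supported functions on lists that are obtained from the
lexicographic ordering by the maps `spread`. -/
def spreadLt (C : Type u) [Field C] [LinearOrder C] (i : I) (f g : List (ℕ × I) →₀ C) : Prop :=
  toLex (spread C i f) < toLex (spread C i g)

variable [IsStrictOrderedRing C]

theorem isIOrdered_spreadLt : IsIOrdered C (spreadLt (I := I) C) where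
  irrefl _ _ := lt_irrefl _
  trans _ _ _ _ := lt_trans
  total i x y := by
    rcases lt_trichotomy (toLex (spread C i x)) (toLex (spread C i y)) with h | h | h
    · exact Or.inl h
    · exact Or.inr (Or.inl (spread_injective i (toLex.injective h)))
    · exact Or.inr (Or.inr h)
  add_lt i x y z h := by
    simp only [spreadLt, map_add, toLex_add]
    exact add_lt_add_left h _
  smul_pos i c x hc h := by
    obtain ⟨j, hj, hj'⟩ := Finsupp.Lex.lt_iff.1 h
    refine Finsupp.Lex.lt_iff.2 ⟨j, fun d hd => ?_, ?_⟩
    · have := hj d hd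
      simp only [map_zero, ofLex_toLex, Finsupp.coe_zero, Pi.zero_apply] at this
      simp [← this]
    · simp only [map_zero, ofLex_toLex, Finsupp.coe_zero, Pi.zero_apply] at hj'
      simpa using mul_pos hc hj'

/-- A nonempty interval of the lexicographic ordering contains everything that agrees with its
midpoint up to some level. -/
theorem exists_level_between {f g : List (ℕ × I) →₀ C} (h : toLex f < toLex g) :
    ∃ (p : List (ℕ × I) →₀ C) (N : ℕ), ∀ q : List (ℕ × I) →₀ C,
      (∀ y, level y ≤ N → q y = p y) → toLex f < toLex q ∧ toLex q < toLex g := by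
  obtain ⟨j, hj, hj'⟩ := Finsupp.Lex.lt_iff.1 h
  simp only [ofLex_toLex] at hj hj'
  -- Coordinates before the first difference `j` have level at most `level j`, so agreement up to
  -- that level settles both lexicographic comparisons.
  refine ⟨(2⁻¹ : C) • (f + g), level j, fun q hq => ?_⟩
  have hle : ∀ d, d < j → level d ≤ level j := fun d hd =>
    not_lt.1 fun h' => lt_asymm hd (levelOrder_lt h')
  have hq' : ∀ d, d < j → q d = f d := fun d hd => by
    rw [hq d (hle d hd), Finsupp.smul_apply, Finsupp.add_apply, ← hj d hd, ← two_mul,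
      smul_eq_mul, inv_mul_cancel_left₀ two_ne_zero]
  have hqj : q j = 2⁻¹ * (f j + g j) := hq j le_rfl
  constructor
  · refine Finsupp.Lex.lt_iff.2 ⟨j, fun d hd => (hq' d hd).symm, ?_⟩
    simp only [ofLex_toLex, hqj]
    linarith
  · refine Finsupp.Lex.lt_iff.2 ⟨j, fun d hd => (hq' d hd).trans (hj d hd), ?_⟩
    simp only [ofLex_toLex, hqj]
    linarith

theorem isIndependent_spreadLt : IsIndependent (spreadLt (I := I) C) := by
  refine isIOrdered_spreadLt.isIndependent_of_forall fun n i a b hab => ?_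
  choose p N hp using fun k => exists_level_between (hab k)
  -- The largest of the finitely many required levels works for all intervals at once.
  obtain ⟨s, hs⟩ := exists_spread_eq i p (Finset.univ.sup N)
  exact ⟨s, fun k => hp k _ fun y hy => hs k y (hy.trans (Finset.le_sup (Finset.mem_univ k)))⟩

end Existence

theorem isSatisfiable_theoryTCI (C : Type u) [Field C] [LinearOrder C] [IsStrictOrderedRing C]
    (I : Type v) : (theoryTCI C I).IsSatisfiable := by
  let S : (lang C I).Structure (List (ℕ × I) →₀ C) := toStructure C (spreadLt C)
  have : (List (ℕ × I) →₀ C) ⊨ theoryTCI C I :=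
    model_theoryTCI_iff.2 ⟨_, _, _, rfl, isIOrdered_spreadLt, isIndependent_spreadLt⟩
  exact ⟨.of _ (List (ℕ × I) →₀ C)⟩

theorem isComplete_theoryTCI (C : Type u) [Field C] [LinearOrder C] [IsStrictOrderedRing C]
    (I : Type v) [Nonempty I] : (theoryTCI C I).IsComplete := by
  obtain ⟨M⟩ := isSatisfiable_theoryTCI C I
  refine ⟨⟨M⟩, fun φ => ?_⟩
  obtain ⟨_, _, lt, hS, h, hi⟩ := model_theoryTCI_iff.1 M.is_model
  have key : ∀ N : Language.Theory.ModelType.{u, v, max u v} (theoryTCI C I), M ⊨ φ ↔ N ⊨ φ := by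
    intro N
    obtain ⟨_, _, lt', hS', h', hi'⟩ := model_theoryTCI_iff.1 N.is_model
    refine realize_iff_of_sameSign hS hS' h h' hi hi' φ fun i f => ?_
    -- A sentence has no free variables, so the zero form is the only one to compare.
    rw [Subsingleton.elim f 0, map_zero, map_zero]
    exact SameSign.zero h h'
  simp only [Language.Theory.models_sentence_iff, Language.Sentence.realize_not]
  by_cases hM : M ⊨ φ
  · exact Or.inl fun N => (key N).1 hM
  · exact Or.inr fun N => mt (key N).2 hM

end DistalTCI

theorem corollary3 (C : Type u) [Field C] [LinearOrder C] [IsStrictOrderedRing C]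
    (I : Type v) [Nonempty I] :
    DistalTCI.IsDistal.{u, v, w, w'} (DistalTCI.theoryTCI C I) := by
  refine ⟨DistalTCI.isComplete_theoryTCI C I, fun M _ hM => ?_⟩
  obtain ⟨_, _, lt, hS, h, hi⟩ := DistalTCI.model_theoryTCI_iff.1 hM
  exact DistalTCI.distalIn_of_eq hS h hi
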